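/- Let $\mathcal H_A,\mathcal H_B$ be finite-dimensional complex Hilbert spaces. Let $\mathrm{SEP}(A;B)$ be the set of all finite sums $\sum_i X_i^A\otimes X_i^B$ with $X_i^A$, $X_i^B$ positive semidefinite operators on $\mathcal H_A$, $\mathcal H_B$, and let $\mathrm{SEP}^*(A;B)$ be the set of all Hermitian operators $Y$ on $\mathcal H_A\otimes\mathcal H_B$ such that $\operatorname{Tr} XY\ge 0$ for all $X\in\mathrm{SEP}(A;B)$. A state of SEP is an element of $\mathrm{SEP}(A;B)$ with trace one, and it is pure if it is an extreme point of the set of all states of SEP. A measurement of SEP is a finite family $\{M_i\}_i$ in $\mathrm{SEP}^*(A;B)$ with $\sum_i M_i=I$. States $\rho_1,\dots,\rho_n$ are perfectly distinguishable in SEP if there is a measurement $\{M_j\}_{j=1}^n$ of SEP with $\operatorname{Tr} M_j\rho_i=\delta_{ij}$ for all $i,j$. Let $\rho_1=\rho_1^A\otimes\rho_1^B$ and $\rho_2=\rho_2^A\otimes\rho_2^B$ be pure states of SEP, where $\rho_i^A$ and $\rho_i^B$ ($i=1,2$) are positive semidefinite operators of trace one on $\mathcal H_A$ and $\mathcal H_B$.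 Then $\rho_1$ and $\rho_2$ are perfectly distinguishable in SEP if and only if $$\operatorname{Tr}\rho_1^A\rho_2^A+\operatorname{Tr}\rho_1^B\rho_2^B\le 1.$$ -/

import Mathlib

open scoped TensorProduct

noncomputable section

/-- A density operator, i.e. a state of quantum theory on the Hilbert space `H`:
a positive semidefinite operator of trace one. -/
def IsDensity {H : Type*} [NormedAddCommGroup H] [InnerProductSpace ℂ H]
    (ρ : H →ₗ[ℂ] H) : Prop :=
  ρ.IsPositive ∧ LinearMap.trace ℂ H ρ = 1

/-- The cone `SEP(A;B)`: finite sums of tensor products of positive semidefinite operators. -/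
def SEP (HA HB : Type*) [NormedAddCommGroup HA] [InnerProductSpace ℂ HA]
    [NormedAddCommGroup HB] [InnerProductSpace ℂ HB] :
    Set ((HA ⊗[ℂ] HB) →ₗ[ℂ] (HA ⊗[ℂ] HB)) :=
  {Z | ∃ (n : ℕ) (X : Fin n → (HA →ₗ[ℂ] HA)) (Y : Fin n → (HB →ₗ[ℂ] HB)),
    (∀ i, (X i).IsPositive) ∧ (∀ i, (Y i).IsPositive) ∧
      Z = ∑ i, TensorProduct.map (X i) (Y i)}

/-- The dual cone `SEP*(A;B)`: Hermitian operators `Y` with `Tr XY ≥ 0` for all `X ∈ SEP(A;B)`.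
The trace of a product of two Hermitian operators is real, so its real part is the trace itself. -/
def SEPDual (HA HB : Type*) [NormedAddCommGroup HA] [InnerProductSpace ℂ HA]
    [NormedAddCommGroup HB] [InnerProductSpace ℂ HB] :
    Set ((HA ⊗[ℂ] HB) →ₗ[ℂ] (HA ⊗[ℂ] HB)) :=
  {Y | Y.IsSymmetric ∧ ∀ X ∈ SEP HA HB, 0 ≤ (LinearMap.trace ℂ (HA ⊗[ℂ] HB) (X ∘ₗ Y)).re}

/-- The states of SEP: the elements of the cone `SEP(A;B)` with trace one. -/
def SEPStates (HA HB : Type*) [NormedAddCommGroup HA] [InnerProductSpace ℂ HA]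
    [NormedAddCommGroup HB] [InnerProductSpace ℂ HB] :
    Set ((HA ⊗[ℂ] HB) →ₗ[ℂ] (HA ⊗[ℂ] HB)) :=
  {ρ | ρ ∈ SEP HA HB ∧ LinearMap.trace ℂ (HA ⊗[ℂ] HB) ρ = 1}

/-- A pure state of SEP: an extreme point of the convex set of states, i.e. a state that is not a
proper convex combination of other states. (Written out, with real weights read in `ℂ`, because
there are two syntactically different real scalar actions on the operators.) -/
def IsPureSEPState {HA HB : Type*} [NormedAddCommGroup HA] [InnerProductSpace ℂ HA]
    [NormedAddCommGroup HB] [InnerProductSpace ℂ HB]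
    (ρ : (HA ⊗[ℂ] HB) →ₗ[ℂ] (HA ⊗[ℂ] HB)) : Prop :=
  ρ ∈ SEPStates HA HB ∧
    ∀ σ ∈ SEPStates HA HB, ∀ τ ∈ SEPStates HA HB, ∀ t : ℝ, 0 < t → t < 1 →
      ρ = (t : ℂ) • σ + ((1 - t : ℝ) : ℂ) • τ → σ = ρ ∧ τ = ρ

/-- A measurement of SEP: a finite family of elements of the dual cone summing to the identity. -/
def IsSEPMeasurement {HA HB : Type*} [NormedAddCommGroup HA] [InnerProductSpace ℂ HA]
    [NormedAddCommGroup HB] [InnerProductSpace ℂ HB] {n : ℕ}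
    (M : Fin n → ((HA ⊗[ℂ] HB) →ₗ[ℂ] (HA ⊗[ℂ] HB))) : Prop :=
  (∀ i, M i ∈ SEPDual HA HB) ∧ ∑ i, M i = LinearMap.id

/-- A family of states is perfectly distinguishable in SEP if some measurement of SEP satisfies
`Tr M_j ρ_i = δ_ij`. -/
def PerfectlyDistinguishable {HA HB : Type*} [NormedAddCommGroup HA] [InnerProductSpace ℂ HA]
    [NormedAddCommGroup HB] [InnerProductSpace ℂ HB] {n : ℕ}
    (ρ : Fin n → ((HA ⊗[ℂ] HB) →ₗ[ℂ] (HA ⊗[ℂ] HB))) : Prop :=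
  ∃ M : Fin n → ((HA ⊗[ℂ] HB) →ₗ[ℂ] (HA ⊗[ℂ] HB)), IsSEPMeasurement M ∧
    ∀ i j, LinearMap.trace ℂ (HA ⊗[ℂ] HB) (M j ∘ₗ ρ i) = if i = j then 1 else 0

end

/-! Purity makes every factor a rank-one projection, so the states are `|aᵢ ⊗ bᵢ⟩` with overlaps `r
= |⟨a₁, a₂⟩|`, `r' = |⟨b₁, b₂⟩|`, and the criterion reads `r² + r'² ≤ 1`. Membership in `SEPDual`
only concerns expectations at product vectors (`mem_SEPDual_iff`).

Necessity: test both effects on the mixed vector `a₁ ⊗ b₂`. With `a₁` fixed, `M₀` becomes an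
operator on `HB` between 0 and 1 with expectation 1 at `b₁`, so it dominates `|b₁⟩⟨b₁|` and `M₀` has
expectation at least `r'²`. With `b₂` fixed, `M₁` likewise gives at least `r²`. The two expectations
add up to 1.

Sufficiency: take `e ⊥ a₁` and `f ⊥ b₁` in the planes of the two pairs. The effect `sepEffect` is
the average of `|ψ⟩⟨ψ|`, `ψ = a₁ ⊗ b₁ + c e ⊗ f`, and its partial transpose. For `|c| ≤ 1` it and
its complement are nonnegative on product vectors, and at `a₂ ⊗ b₂` it equals `(r r' + c s s')²`,
with `s² = 1 - r²`, `s'² = 1 - r'²`. The criterion is what allows a root `c` with `|c| ≤ 1`. -/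

open InnerProductSpace in
/-- The operator `|x⟩⟨y|`. -/
noncomputable def ketBra {H : Type*} [NormedAddCommGroup H] [InnerProductSpace ℂ H] (x y : H) :
    H →ₗ[ℂ] H := (rankOne ℂ x y).toLinearMap

/-- The expectation `⟨x, T x⟩` of the operator `T` at the vector `x`. -/
noncomputable def expVal {H : Type*} [NormedAddCommGroup H] [InnerProductSpace ℂ H]
    (T : H →ₗ[ℂ] H) (x : H) : ℂ := inner ℂ x (T x)

/-! ### Rank-one operators, expectations and positivity on one Hilbert space. -/

section Hilbert

variable {H : Type*} [NormedAddCommGroup H] [InnerProductSpace ℂ H]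

@[simp] theorem ketBra_apply (x y z : H) : ketBra x y z = inner ℂ y z • x := rfl

theorem isPositive_ketBra_self (x : H) : (ketBra x x).IsPositive :=
  (ContinuousLinearMap.isPositive_toLinearMap_iff _).2 (InnerProductSpace.isPositive_rankOne_self x)

theorem inner_self_eq_ofReal_norm_sq (x : H) : inner ℂ x x = ((‖x‖ ^ 2 : ℝ) : ℂ) := by
  rw [inner_self_eq_norm_sq_to_K]; norm_cast

theorem expVal_add (S T : H →ₗ[ℂ] H) (x : H) : expVal (S + T) x = expVal S x + expVal T x :=
  inner_add_right _ _ _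

theorem expVal_sub (S T : H →ₗ[ℂ] H) (x : H) : expVal (S - T) x = expVal S x - expVal T x :=
  inner_sub_right _ _ _

theorem expVal_smul (c : ℂ) (T : H →ₗ[ℂ] H) (x : H) : expVal (c • T) x = c * expVal T x :=
  inner_smul_right _ _ _

theorem expVal_id (x : H) : expVal LinearMap.id x = ((‖x‖ ^ 2 : ℝ) : ℂ) :=
  inner_self_eq_ofReal_norm_sq x

theorem inner_ketBra_self (a x : H) :
    inner ℂ x (ketBra a a x) = ((‖inner ℂ a x‖ ^ 2 : ℝ) : ℂ) := by
  rw [ketBra_apply, inner_smul_right, ← inner_conj_symm x a, Complex.mul_conj,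
    Complex.normSq_eq_norm_sq]

theorem inner_ketBra_add_ketBra (a e x : H) :
    inner ℂ x ((ketBra a e + ketBra e a) x) =
      ((2 * (inner ℂ a x * (starRingEnd ℂ) (inner ℂ e x)).re : ℝ) : ℂ) := by
  simp only [LinearMap.add_apply, ketBra_apply, inner_add_right, inner_smul_right]
  rw [← inner_conj_symm x a, ← inner_conj_symm x e]
  generalize inner ℂ a x = z
  generalize inner ℂ e x = w
  apply Complex.ext
  · simp; ring
  · simp; ring

theorem isSymmetric_ketBra_add_ketBra (a e : H) : (ketBra a e + ketBra e a).IsSymmetric := by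
  intro x y
  simp only [LinearMap.add_apply, ketBra_apply, inner_add_right, inner_add_left, inner_smul_right,
    inner_smul_left, inner_conj_symm]
  ring

theorem norm_sub_inner_smul_sq {a : H} (ha : ‖a‖ = 1) (x : H) :
    ‖x - inner ℂ a x • a‖ ^ 2 = ‖x‖ ^ 2 - ‖inner ℂ a x‖ ^ 2 := by
  have h : inner ℂ (inner ℂ a x • a) (x - inner ℂ a x • a) = 0 := by
    rw [inner_smul_left, inner_sub_right, inner_smul_right, inner_self_eq_ofReal_norm_sq, ha]
    simp
  have h2 := norm_add_sq_eq_norm_sq_add_norm_sq_of_inner_eq_zero _ _ h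
  rw [add_sub_cancel, norm_smul, ha] at h2
  linarith

theorem norm_inner_sq_add_norm_inner_sq_le {a e : H} (ha : ‖a‖ = 1) (he : ‖e‖ ≤ 1)
    (hae : inner ℂ a e = 0) (x : H) :
    ‖inner ℂ a x‖ ^ 2 + ‖inner ℂ e x‖ ^ 2 ≤ ‖x‖ ^ 2 := by
  have h1 : inner ℂ e x = inner ℂ e (x - inner ℂ a x • a) := by
    rw [inner_sub_right, inner_smul_right, inner_eq_zero_symm.1 hae, mul_zero, sub_zero]
  have h2 : ‖inner ℂ e x‖ ≤ ‖x - inner ℂ a x • a‖ := by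
    rw [h1]
    refine (norm_inner_le_norm _ _).trans ?_
    exact mul_le_of_le_one_left (norm_nonneg _) he
  have h3 := pow_le_pow_left₀ (norm_nonneg _) h2 2
  rw [norm_sub_inner_smul_sq ha] at h3
  linarith

/-- In the plane of two unit vectors one can complete the first one by an orthogonal vector with
respect to which the second one has nonnegative coordinates, up to a common phase. -/
theorem exists_orthogonal_of_norm_eq_one {a x : H} (ha : ‖a‖ = 1) (hx : ‖x‖ = 1) :
    ∃ (e : H) (s : ℝ), ‖e‖ ≤ 1 ∧ inner ℂ a e = 0 ∧ 0 ≤ s ∧ ‖inner ℂ a x‖ ^ 2 + s ^ 2 = 1 ∧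
      ‖inner ℂ e x‖ = s ∧
      inner ℂ a x * (starRingEnd ℂ) (inner ℂ e x) = ((‖inner ℂ a x‖ * s : ℝ) : ℂ) := by
  set z := inner ℂ a x with hz
  set w := x - z • a with hw
  have hwn : ‖w‖ ^ 2 = 1 - ‖z‖ ^ 2 := by rw [hw, norm_sub_inner_smul_sq ha, hx, one_pow]
  have haw : inner ℂ a w = 0 := by
    rw [hw, inner_sub_right, inner_smul_right, inner_self_eq_ofReal_norm_sq, ha]
    simp [hz]
  have hwx : inner ℂ w x = ((‖w‖ ^ 2 : ℝ) : ℂ) := by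
    rw [← inner_self_eq_ofReal_norm_sq]
    nth_rewrite 3 [hw]
    rw [inner_sub_right, inner_smul_right, inner_eq_zero_symm.1 haw, mul_zero, sub_zero]
  -- The phase `c` with `c * z = ‖z‖` is absorbed into `e`, which makes the product of coordinates
  -- real and nonnegative.
  obtain ⟨c, hc, hcz⟩ := RCLike.exists_norm_eq_mul_self z
  have hex : inner ℂ ((c * ((‖w‖⁻¹ : ℝ) : ℂ)) • w) x = (starRingEnd ℂ) c * ((‖w‖ : ℝ) : ℂ) := by
    rw [inner_smul_left, hwx, map_mul, Complex.conj_ofReal, mul_assoc, ← Complex.ofReal_mul]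
    congr 2
    rcases eq_or_ne ‖w‖ 0 with h | h
    · simp [h]
    · field_simp
  -- If `w = 0`, the convention `0⁻¹ = 0` yields `e = 0` and `s = 0`.
  refine ⟨(c * ((‖w‖⁻¹ : ℝ) : ℂ)) • w, ‖w‖, ?_, ?_, norm_nonneg _, by linarith, ?_, ?_⟩
  · rw [norm_smul, norm_mul, hc, one_mul, Complex.norm_real, norm_inv, norm_norm]
    exact inv_mul_le_one
  · rw [inner_smul_right, haw, mul_zero]
  · rw [hex, norm_mul, RCLike.norm_conj, hc]
    simp
  · rw [hex, map_mul, Complex.conj_conj, Complex.conj_ofReal, ← mul_assoc, mul_comm z c, ← hcz]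
    push_cast
    rfl

/-- Positivity of `T` at the component of `x` orthogonal to the fixed vector `b` gives `T ≥ |b⟩⟨b|`.
-/
theorem LinearMap.IsPositive.norm_inner_sq_le {T : H →ₗ[ℂ] H} (hT : T.IsPositive)
    {b : H} (hb : T b = b) (hb1 : ‖b‖ = 1) (x : H) :
    ‖inner ℂ b x‖ ^ 2 ≤ (inner ℂ x (T x)).re := by
  have h := hT.re_inner_nonneg_right (x - inner ℂ b x • b)
  have h1 : inner ℂ b (T x) = inner ℂ b x := by
    rw [← hT.isSymmetric b x, hb]
  have h2 : inner ℂ b b = 1 := by simp [inner_self_eq_norm_sq_to_K, hb1]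
  simp only [map_sub, map_smul, hb, inner_sub_left, inner_sub_right, inner_smul_left,
    inner_smul_right, h1, h2] at h
  have h3 : inner ℂ b x * inner ℂ x b = ((‖inner ℂ b x‖ ^ 2 : ℝ) : ℂ) := by
    rw [← inner_conj_symm x b, Complex.mul_conj, Complex.normSq_eq_norm_sq]
  rw [inner_conj_symm, mul_one, sub_self, mul_zero, mul_comm, h3] at h
  simp only [RCLike.re_to_complex, Complex.ofReal_re, Complex.zero_re] at h
  linarith

variable [FiniteDimensional ℂ H]

theorem trace_ketBra (x y : H) : LinearMap.trace ℂ H (ketBra x y) = inner ℂ y x :=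
  InnerProductSpace.trace_rankOne x y

theorem trace_comp_ketBra (T : H →ₗ[ℂ] H) (x y : H) :
    LinearMap.trace ℂ H (T ∘ₗ ketBra x y) = inner ℂ y (T x) := by
  have : T ∘ₗ ketBra x y = ketBra (T x) y := by ext z; simp
  rw [this, trace_ketBra]

theorem trace_comp_ketBra_self (T : H →ₗ[ℂ] H) (x : H) :
    LinearMap.trace ℂ H (T ∘ₗ ketBra x x) = expVal T x :=
  trace_comp_ketBra T x x

theorem trace_ketBra_self_comp (T : H →ₗ[ℂ] H) (x : H) :
    LinearMap.trace ℂ H (ketBra x x ∘ₗ T) = expVal T x := by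
  rw [LinearMap.trace_comp_comm', trace_comp_ketBra_self]

theorem LinearMap.IsPositive.exists_eq_sum_ketBra {T : H →ₗ[ℂ] H} (hT : T.IsPositive) :
    ∃ (m : ℕ) (u : Fin m → H), T = ∑ i, ketBra (u i) (u i) := by
  obtain ⟨m, u, h⟩ := ContinuousLinearMap.isPositive_iff_eq_sum_rankOne.1
    ((LinearMap.isPositive_toContinuousLinearMap_iff T).2 hT)
  refine ⟨m, u, ?_⟩
  ext z
  simpa [ketBra] using congrArg (fun S : H →L[ℂ] H => S z) h

theorem LinearMap.IsPositive.apply_eq_zero_of_re_inner_eq_zero {T : H →ₗ[ℂ] H}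
    (hT : T.IsPositive) {x : H} (hx : (inner ℂ x (T x)).re = 0) : T x = 0 := by
  obtain ⟨m, u, rfl⟩ := hT.exists_eq_sum_ketBra
  have key : ∀ i, inner ℂ (u i) x = 0 := by
    have h : ∑ i, ‖inner ℂ (u i) x‖ ^ 2 = 0 := by
      rw [← hx]
      simp only [LinearMap.sum_apply, ketBra_apply, inner_sum, inner_smul_right, Complex.re_sum]
      refine Finset.sum_congr rfl fun i _ => ?_
      rw [← inner_smul_right, ← ketBra_apply, inner_ketBra_self, Complex.ofReal_re]
    intro i
    have := (Finset.sum_eq_zero_iff_of_nonneg fun i _ => by positivity).1 h i (Finset.mem_univ i)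
    simpa using this
  simp [key]

/-- If the compression of `M` along an isometry `J` lies between `0` and `1` and has expectation
one at the unit vector `b`, then it dominates the projection onto `b`. -/
theorem norm_inner_sq_le_of_compression {K : Type*} [NormedAddCommGroup K] [InnerProductSpace ℂ K]
    [FiniteDimensional ℂ K] {M : K →ₗ[ℂ] K} (hM : M.IsSymmetric) (J : H →ₗ[ℂ] K)
    (h0 : ∀ y, 0 ≤ (expVal M (J y)).re)
    (h1 : ∀ y, (expVal M (J y)).re ≤ ‖y‖ ^ 2)
    {b : H} (hb : ‖b‖ = 1) (hMb : (expVal M (J b)).re = 1) (x : H) :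
    ‖inner ℂ b x‖ ^ 2 ≤ (expVal M (J x)).re := by
  set T : H →ₗ[ℂ] H := J.adjoint ∘ₗ M ∘ₗ J with hT
  have hin : ∀ y z, inner ℂ y (T z) = inner ℂ (J y) (M (J z)) := fun y z => by
    simp [hT, LinearMap.adjoint_inner_right]
  have hsymm : T.IsSymmetric := fun y z => by
    rw [hin, ← inner_conj_symm, hin, inner_conj_symm, hM]
  have hpos : T.IsPositive := ⟨hsymm, fun y => by
    rw [hsymm, hin]; exact h0 y⟩
  have hpos' : (LinearMap.id - T).IsPositive := by
    refine ⟨LinearMap.IsSymmetric.id.sub hsymm, fun y => ?_⟩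
    have h1y := h1 y
    rw [expVal] at h1y
    rw [(LinearMap.IsSymmetric.id.sub hsymm) y y, LinearMap.sub_apply, inner_sub_right, hin]
    simpa [inner_self_eq_norm_sq_to_K, ← Complex.ofReal_pow] using h1y
  -- The positive operator `1 - T` has zero expectation at `b`, hence annihilates it.
  have hTb : T b = b := by
    have := hpos'.apply_eq_zero_of_re_inner_eq_zero (x := b) (by
      rw [LinearMap.sub_apply, inner_sub_right, hin]
      rw [expVal] at hMb
      simp [inner_self_eq_norm_sq_to_K, hb, hMb])
    rw [LinearMap.sub_apply, sub_eq_zero] at this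
    exact this.symm
  rw [expVal, ← hin]
  exact hpos.norm_inner_sq_le hTb hb x

end Hilbert

/-! ### Pure product states have rank-one factors. -/

section Pure

variable {H : Type*} [NormedAddCommGroup H] [InnerProductSpace ℂ H]

theorem IsDensity.exists_apply_ne_zero {ρ : H →ₗ[ℂ] H} (hρ : IsDensity ρ) : ∃ x, ρ x ≠ 0 := by
  by_contra! h
  have : ρ = 0 := LinearMap.ext h
  simpa [this] using hρ.2

variable [FiniteDimensional ℂ H]

theorem isDensity_ketBra_self {x : H} (hx : ‖x‖ = 1) : IsDensity (ketBra x x) :=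
  ⟨isPositive_ketBra_self x, by simp [trace_ketBra, hx]⟩

/-- A density operator which is an extreme point is a rank-one projection. -/
theorem IsDensity.exists_eq_ketBra {ρ : H →ₗ[ℂ] H} (hρ : IsDensity ρ)
    (hext : ∀ σ τ : H →ₗ[ℂ] H, IsDensity σ → IsDensity τ → ∀ t : ℝ, 0 < t → t < 1 →
      ρ = (t : ℂ) • σ + ((1 - t : ℝ) : ℂ) • τ → σ = ρ) :
    ∃ a : H, ‖a‖ = 1 ∧ ρ = ketBra a a := by
  obtain ⟨m, u, hu⟩ := hρ.1.exists_eq_sum_ketBra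
  have htr : ∑ i, ‖u i‖ ^ 2 = 1 := by
    have h := hρ.2
    simp only [hu, map_sum, trace_ketBra, inner_self_eq_ofReal_norm_sq] at h
    exact_mod_cast h
  obtain ⟨i, hi⟩ : ∃ i, u i ≠ 0 := by
    by_contra! h
    simp [h] at htr
  have hpos : 0 < ‖u i‖ := norm_pos_iff.2 hi
  rw [← Finset.add_sum_erase _ _ (Finset.mem_univ i)] at htr hu
  set t : ℝ := ‖u i‖ ^ 2 with ht
  have ht0 : 0 < t := by positivity
  have hrest : 0 ≤ ∑ j ∈ Finset.univ.erase i, ‖u j‖ ^ 2 :=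
    Finset.sum_nonneg fun j _ => by positivity
  -- The normalised term of `u i` has weight `t`. For `t < 1` extremality identifies it with `ρ`;
  -- otherwise all other terms vanish.
  rcases lt_or_ge t 1 with ht1 | ht1
  · have hu1 : ‖((‖u i‖⁻¹ : ℝ) : ℂ) • u i‖ = 1 := by
      rw [norm_smul, Complex.norm_real, norm_inv, norm_norm, inv_mul_cancel₀ hpos.ne']
    have ht1' : 0 < 1 - t := by linarith
    refine ⟨_, hu1, (hext _ ((((1 - t)⁻¹ : ℝ) : ℂ) •
      ∑ j ∈ Finset.univ.erase i, ketBra (u j) (u j)) (isDensity_ketBra_self hu1) ⟨?_, ?_⟩ t ht0 ht1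
      ?_).symm⟩
    · refine LinearMap.IsPositive.smul_of_nonneg
        (LinearMap.isPositive_sum _ fun j _ => isPositive_ketBra_self _) ?_
      exact Complex.zero_le_real.2 (inv_nonneg.2 ht1'.le)
    · simp only [map_smul, map_sum, trace_ketBra, inner_self_eq_ofReal_norm_sq, smul_eq_mul]
      have : ∑ j ∈ Finset.univ.erase i, ‖u j‖ ^ 2 = 1 - t := by linarith
      have h2 : (1 - t)⁻¹ * ∑ j ∈ Finset.univ.erase i, ‖u j‖ ^ 2 = 1 := by
        rw [this, inv_mul_cancel₀ ht1'.ne']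
      exact_mod_cast congrArg (fun r : ℝ => (r : ℂ)) h2
    · rw [smul_smul, ← Complex.ofReal_mul, mul_inv_cancel₀ ht1'.ne', Complex.ofReal_one, one_smul,
        hu]
      congr 1
      ext z
      simp only [LinearMap.smul_apply, ketBra_apply, inner_smul_left, smul_smul, Complex.conj_ofReal]
      congr 1
      have : ((t : ℝ) : ℂ) * (((‖u i‖⁻¹ : ℝ) : ℂ) * ((‖u i‖⁻¹ : ℝ) : ℂ)) = 1 := by
        rw [← Complex.ofReal_mul, ← Complex.ofReal_mul, ht]
        norm_cast
        field_simp
      linear_combination (-inner ℂ (u i) z) * this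
  · have h0 : ∑ j ∈ Finset.univ.erase i, ‖u j‖ ^ 2 = 0 := by linarith
    have hz : ∀ j ∈ Finset.univ.erase i, u j = 0 := fun j hj => by
      simpa using (Finset.sum_eq_zero_iff_of_nonneg fun j _ => by positivity).1 h0 j hj
    refine ⟨u i, ?_, ?_⟩
    · have : ‖u i‖ ^ 2 = 1 := by linarith
      simpa [pow_eq_one_iff_of_nonneg] using this
    · rw [hu, Finset.sum_eq_zero, add_zero]
      intro j hj
      ext z
      simp [hz j hj]

variable {HA HB : Type*} [NormedAddCommGroup HA] [InnerProductSpace ℂ HA]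
  [NormedAddCommGroup HB] [InnerProductSpace ℂ HB]

theorem tmul_eq_zero_iff (x : HA) (y : HB) : x ⊗ₜ[ℂ] y = 0 ↔ x = 0 ∨ y = 0 := by
  rw [← norm_eq_zero, TensorProduct.norm_tmul, mul_eq_zero, norm_eq_zero, norm_eq_zero]

theorem IsDensity.map_left_injective {ρ : HB →ₗ[ℂ] HB} (hρ : IsDensity ρ) :
    Function.Injective fun X : HA →ₗ[ℂ] HA => TensorProduct.map X ρ := by
  intro X X' h
  obtain ⟨y, hy⟩ := hρ.exists_apply_ne_zero
  ext x
  have h1 := congrArg (fun T => T (x ⊗ₜ[ℂ] y)) h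
  simp only [TensorProduct.map_tmul] at h1
  rw [← sub_eq_zero, ← TensorProduct.sub_tmul, tmul_eq_zero_iff] at h1
  exact sub_eq_zero.1 (h1.resolve_right hy)

theorem IsDensity.map_right_injective {ρ : HA →ₗ[ℂ] HA} (hρ : IsDensity ρ) :
    Function.Injective fun Y : HB →ₗ[ℂ] HB => TensorProduct.map ρ Y := by
  intro Y Y' h
  obtain ⟨x, hx⟩ := hρ.exists_apply_ne_zero
  ext y
  have h1 := congrArg (fun T => T (x ⊗ₜ[ℂ] y)) h
  simp only [TensorProduct.map_tmul] at h1
  rw [← sub_eq_zero, ← TensorProduct.tmul_sub, tmul_eq_zero_iff] at h1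
  exact sub_eq_zero.1 (h1.resolve_left hx)

variable [FiniteDimensional ℂ HA] [FiniteDimensional ℂ HB]

theorem IsDensity.map_mem_SEPStates {ρ : HA →ₗ[ℂ] HA} {σ : HB →ₗ[ℂ] HB} (hρ : IsDensity ρ)
    (hσ : IsDensity σ) : TensorProduct.map ρ σ ∈ SEPStates HA HB := by
  refine ⟨⟨1, fun _ => ρ, fun _ => σ, fun _ => hρ.1, fun _ => hσ.1, by simp⟩, ?_⟩
  rw [LinearMap.trace_tensorProduct', hρ.2, hσ.2, one_mul]

/-- Tensoring a convex decomposition of `ρ` with `σ` decomposes the product state, and this map is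
injective, so extremality descends to the factor. -/
theorem IsPureSEPState.exists_left_eq_ketBra {ρ : HA →ₗ[ℂ] HA} {σ : HB →ₗ[ℂ] HB}
    (h : IsPureSEPState (TensorProduct.map ρ σ)) (hρ : IsDensity ρ) (hσ : IsDensity σ) :
    ∃ a : HA, ‖a‖ = 1 ∧ ρ = ketBra a a := by
  refine hρ.exists_eq_ketBra fun X X' hX hX' t h0 h1 he => hσ.map_left_injective ?_
  refine (h.2 _ (hX.map_mem_SEPStates hσ) _ (hX'.map_mem_SEPStates hσ) t h0 h1 ?_).1
  rw [he, TensorProduct.map_add_left, TensorProduct.map_smul_left, TensorProduct.map_smul_left]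

theorem IsPureSEPState.exists_right_eq_ketBra {ρ : HA →ₗ[ℂ] HA} {σ : HB →ₗ[ℂ] HB}
    (h : IsPureSEPState (TensorProduct.map ρ σ)) (hρ : IsDensity ρ) (hσ : IsDensity σ) :
    ∃ b : HB, ‖b‖ = 1 ∧ σ = ketBra b b := by
  refine hσ.exists_eq_ketBra fun Y Y' hY hY' t h0 h1 he => hρ.map_right_injective ?_
  refine (h.2 _ (hρ.map_mem_SEPStates hY) _ (hρ.map_mem_SEPStates hY') t h0 h1 ?_).1
  rw [he, TensorProduct.map_add_right, TensorProduct.map_smul_right, TensorProduct.map_smul_right]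

end Pure

/-! ### The optimal effect, and both directions of the criterion. -/

section Discrimination

variable {HA HB : Type*} [NormedAddCommGroup HA] [InnerProductSpace ℂ HA]
  [NormedAddCommGroup HB] [InnerProductSpace ℂ HB]

theorem map_ketBra_ketBra (a a' : HA) (b b' : HB) :
    TensorProduct.map (ketBra a a') (ketBra b b') = ketBra (a ⊗ₜ[ℂ] b) (a' ⊗ₜ[ℂ] b') := by
  ext x y
  simp [TensorProduct.smul_tmul', smul_smul, mul_comm]

theorem expVal_map_tmul (S : HA →ₗ[ℂ] HA) (T : HB →ₗ[ℂ] HB) (x : HA) (y : HB) :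
    expVal (TensorProduct.map S T) (x ⊗ₜ[ℂ] y) =
      expVal S x * expVal T y := by
  simp only [expVal, TensorProduct.map_tmul, TensorProduct.inner_tmul]

theorem LinearMap.IsSymmetric.tensorMap {S : HA →ₗ[ℂ] HA} {T : HB →ₗ[ℂ] HB} (hS : S.IsSymmetric)
    (hT : T.IsSymmetric) : (TensorProduct.map S T).IsSymmetric := by
  intro x y
  induction x with
  | zero => simp
  | add x x' h h' => simp only [map_add, inner_add_left, h, h']
  | tmul a b =>
    induction y with
    | zero => simp
    | add y y' h h' => simp only [map_add, inner_add_right, h, h']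
    | tmul a' b' => simp only [TensorProduct.map_tmul, TensorProduct.inner_tmul, hS a a', hT b b']

theorem LinearMap.IsSymmetric.ofReal_smul {H : Type*} [NormedAddCommGroup H]
    [InnerProductSpace ℂ H] {T : H →ₗ[ℂ] H} (hT : T.IsSymmetric) (c : ℝ) :
    ((c : ℂ) • T).IsSymmetric := by
  intro x y
  simp only [LinearMap.smul_apply, inner_smul_left, inner_smul_right, Complex.conj_ofReal, hT x y]

/-- The effect `|ab⟩⟨ab| + c² |ef⟩⟨ef| + (c/2) (|a⟩⟨e| + |e⟩⟨a|) ⊗ (|b⟩⟨f| + |f⟩⟨b|)`. -/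
noncomputable def sepEffect (a e : HA) (b f : HB) (c : ℝ) : (HA ⊗[ℂ] HB) →ₗ[ℂ] (HA ⊗[ℂ] HB) :=
  TensorProduct.map (ketBra a a) (ketBra b b) +
    ((c ^ 2 : ℝ) : ℂ) • TensorProduct.map (ketBra e e) (ketBra f f) +
    ((c / 2 : ℝ) : ℂ) • TensorProduct.map (ketBra a e + ketBra e a) (ketBra b f + ketBra f b)

theorem isSymmetric_sepEffect (a e : HA) (b f : HB) (c : ℝ) :
    (sepEffect a e b f c).IsSymmetric :=
  (((isPositive_ketBra_self a).isSymmetric.tensorMap (isPositive_ketBra_self b).isSymmetric).add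
    (((isPositive_ketBra_self e).isSymmetric.tensorMap
      (isPositive_ketBra_self f).isSymmetric).ofReal_smul _)).add
    (((isSymmetric_ketBra_add_ketBra a e).tensorMap
      (isSymmetric_ketBra_add_ketBra b f)).ofReal_smul _)

theorem expVal_sepEffect (a e : HA) (b f : HB) (c : ℝ) (x : HA) (y : HB) :
    expVal (sepEffect a e b f c) (x ⊗ₜ[ℂ] y) =
      ((‖inner ℂ a x‖ ^ 2 * ‖inner ℂ b y‖ ^ 2 + c ^ 2 * (‖inner ℂ e x‖ ^ 2 * ‖inner ℂ f y‖ ^ 2) +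
        2 * c * (inner ℂ a x * (starRingEnd ℂ) (inner ℂ e x)).re *
          (inner ℂ b y * (starRingEnd ℂ) (inner ℂ f y)).re : ℝ) : ℂ) := by
  rw [sepEffect, expVal_add, expVal_add, expVal_smul, expVal_smul, expVal_map_tmul,
    expVal_map_tmul, expVal_map_tmul]
  simp only [expVal, inner_ketBra_self, inner_ketBra_add_ketBra]
  push_cast
  ring

theorem abs_two_mul_mul_re_mul_re_le (c : ℝ) (z w z' w' : ℂ) :
    |2 * c * (z * (starRingEnd ℂ) w).re * (z' * (starRingEnd ℂ) w').re| ≤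
      2 * |c| * (‖z‖ * ‖w‖ * (‖z'‖ * ‖w'‖)) := by
  have h : ∀ z w : ℂ, |(z * (starRingEnd ℂ) w).re| ≤ ‖z‖ * ‖w‖ := fun z w => by
    simpa using Complex.abs_re_le_norm (z * (starRingEnd ℂ) w)
  rw [mul_assoc, abs_mul, abs_mul, abs_mul, abs_two]
  gcongr
  · exact h z w
  · exact h z' w'

/-- Bounding the cross term by moduli leaves a perfect square. -/
theorem re_expVal_sepEffect_nonneg (a e : HA) (b f : HB) (c : ℝ) (x : HA) (y : HB) :
    0 ≤ (expVal (sepEffect a e b f c) (x ⊗ₜ[ℂ] y)).re := by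
  rw [expVal_sepEffect, Complex.ofReal_re]
  have h := neg_le_of_abs_le (abs_two_mul_mul_re_mul_re_le c (inner ℂ a x) (inner ℂ e x)
    (inner ℂ b y) (inner ℂ f y))
  have h2 := sq_nonneg (‖inner ℂ a x‖ * ‖inner ℂ b y‖ - |c| * (‖inner ℂ e x‖ * ‖inner ℂ f y‖))
  have h3 := sq_abs c
  rw [← h3]
  linarith

/-- The product of the two Bessel inequalities exceeds the bound on the expectation by at least the
square in `h3`. -/
theorem re_expVal_sepEffect_le {a e : HA} {b f : HB} {c : ℝ} (ha : ‖a‖ = 1) (he : ‖e‖ ≤ 1)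
    (hae : inner ℂ a e = 0) (hb : ‖b‖ = 1) (hf : ‖f‖ ≤ 1) (hbf : inner ℂ b f = 0) (hc : |c| ≤ 1)
    (x : HA) (y : HB) :
    (expVal (sepEffect a e b f c) (x ⊗ₜ[ℂ] y)).re ≤ ‖x‖ ^ 2 * ‖y‖ ^ 2 := by
  rw [expVal_sepEffect, Complex.ofReal_re]
  have h := le_of_abs_le (abs_two_mul_mul_re_mul_re_le c (inner ℂ a x) (inner ℂ e x)
    (inner ℂ b y) (inner ℂ f y))
  have hx := norm_inner_sq_add_norm_inner_sq_le ha he hae x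
  have hy := norm_inner_sq_add_norm_inner_sq_le hb hf hbf y
  have hxy := mul_le_mul hx hy (by positivity) (by positivity)
  have hc2 : c ^ 2 ≤ 1 := (sq_le_one_iff_abs_le_one c).2 hc
  have h1 : c ^ 2 * (‖inner ℂ e x‖ ^ 2 * ‖inner ℂ f y‖ ^ 2) ≤
      1 * (‖inner ℂ e x‖ ^ 2 * ‖inner ℂ f y‖ ^ 2) := by gcongr
  have h2 : 2 * |c| * (‖inner ℂ a x‖ * ‖inner ℂ e x‖ * (‖inner ℂ b y‖ * ‖inner ℂ f y‖)) ≤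
      2 * 1 * (‖inner ℂ a x‖ * ‖inner ℂ e x‖ * (‖inner ℂ b y‖ * ‖inner ℂ f y‖)) := by gcongr
  have h3 := sq_nonneg (‖inner ℂ a x‖ * ‖inner ℂ f y‖ - ‖inner ℂ e x‖ * ‖inner ℂ b y‖)
  linarith

theorem expVal_id_tmul (x : HA) (y : HB) :
    expVal LinearMap.id (x ⊗ₜ[ℂ] y) = ((‖x‖ ^ 2 * ‖y‖ ^ 2 : ℝ) : ℂ) := by
  rw [expVal_id, TensorProduct.norm_tmul, mul_pow]

variable [FiniteDimensional ℂ HA] [FiniteDimensional ℂ HB]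

theorem mem_SEPDual_iff {Y : (HA ⊗[ℂ] HB) →ₗ[ℂ] (HA ⊗[ℂ] HB)} :
    Y ∈ SEPDual HA HB ↔
      Y.IsSymmetric ∧ ∀ x y, 0 ≤ (expVal Y (x ⊗ₜ[ℂ] y)).re := by
  refine and_congr_right fun _ => ⟨fun h x y => ?_, fun h => ?_⟩
  · rw [← trace_ketBra_self_comp]
    refine h _ ⟨1, fun _ => ketBra x x, fun _ => ketBra y y, fun _ => isPositive_ketBra_self x,
      fun _ => isPositive_ketBra_self y, ?_⟩
    simp [map_ketBra_ketBra]
  · rintro _ ⟨n, S, T, hS, hT, rfl⟩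
    rw [← Module.End.mul_eq_comp, Finset.sum_mul, map_sum, Complex.re_sum]
    refine Finset.sum_nonneg fun i _ => ?_
    obtain ⟨k, u, hu⟩ := (hS i).exists_eq_sum_ketBra
    obtain ⟨l, v, hv⟩ := (hT i).exists_eq_sum_ketBra
    have : TensorProduct.map (S i) (T i) =
        ∑ p, ∑ q, ketBra (u p ⊗ₜ[ℂ] v q) (u p ⊗ₜ[ℂ] v q) := by
      rw [hu, hv]
      -- The bilinear form of `TensorProduct.map` lets both sums be pulled out by `map_sum`.
      change TensorProduct.mapBilinear (RingHom.id ℂ) _ _ _ _ _ _ = _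
      simp only [map_sum, LinearMap.sum_apply, TensorProduct.mapBilinear_apply, map_ketBra_ketBra]
      rw [Finset.sum_comm]
    rw [this, Finset.sum_mul, map_sum, Complex.re_sum]
    refine Finset.sum_nonneg fun p _ => ?_
    rw [Finset.sum_mul, map_sum, Complex.re_sum]
    refine Finset.sum_nonneg fun q _ => ?_
    rw [Module.End.mul_eq_comp, trace_ketBra_self_comp]
    exact h _ _

/-- The bound `r² + r'² ≤ 1` means `r ≤ s'` and `r' ≤ s`, so the ratio `r r' / (s s')` is at most 1.
If `s s' = 0`, then `r r' = 0` too and `c = 0` serves. -/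
theorem exists_abs_le_one_mul_add_mul_eq_zero {r r' s s' : ℝ} (hr : 0 ≤ r) (hr' : 0 ≤ r')
    (hs : 0 ≤ s) (hs' : 0 ≤ s') (h : r ^ 2 + s ^ 2 = 1) (h' : r' ^ 2 + s' ^ 2 = 1)
    (hle : r ^ 2 + r' ^ 2 ≤ 1) : ∃ c : ℝ, |c| ≤ 1 ∧ r * r' + c * (s * s') = 0 := by
  have h1 : r ≤ s' := abs_le_of_sq_le_sq' (by linarith) hs' |>.2
  have h2 : r' ≤ s := abs_le_of_sq_le_sq' (by linarith) hs |>.2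
  have h3 : r * r' ≤ s * s' := by
    rw [mul_comm s]; exact mul_le_mul h1 h2 hr' hs'
  rcases eq_or_ne (s * s') 0 with h0 | h0
  · refine ⟨0, by simp, ?_⟩
    rw [h0] at h3
    linarith [mul_nonneg hr hr']
  · refine ⟨-(r * r' / (s * s')), ?_, by rw [neg_mul, div_mul_cancel₀ _ h0, add_neg_cancel]⟩
    rw [abs_neg, abs_of_nonneg (by positivity)]
    exact div_le_one_of_le₀ h3 (by positivity)

theorem perfectlyDistinguishable_of_le {a₁ a₂ : HA} {b₁ b₂ : HB} (ha₁ : ‖a₁‖ = 1)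
    (ha₂ : ‖a₂‖ = 1) (hb₁ : ‖b₁‖ = 1) (hb₂ : ‖b₂‖ = 1)
    (h : ‖inner ℂ a₁ a₂‖ ^ 2 + ‖inner ℂ b₁ b₂‖ ^ 2 ≤ 1) :
    PerfectlyDistinguishable ![TensorProduct.map (ketBra a₁ a₁) (ketBra b₁ b₁),
      TensorProduct.map (ketBra a₂ a₂) (ketBra b₂ b₂)] := by
  obtain ⟨e, s, he, hae, hs, hrs, hex, hax⟩ := exists_orthogonal_of_norm_eq_one ha₁ ha₂
  obtain ⟨f, s', hf, hbf, hs', hrs', hfx, hbx⟩ := exists_orthogonal_of_norm_eq_one hb₁ hb₂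
  obtain ⟨c, hc, hc0⟩ := exists_abs_le_one_mul_add_mul_eq_zero (norm_nonneg _) (norm_nonneg _)
    hs hs' hrs hrs' h
  set M := sepEffect a₁ e b₁ f c with hM
  have hsymm : M.IsSymmetric := isSymmetric_sepEffect a₁ e b₁ f c
  have h1 : expVal M (a₁ ⊗ₜ[ℂ] b₁) = 1 := by
    rw [hM, expVal_sepEffect]
    simp [inner_eq_zero_symm.1 hae, ha₁, hb₁]
  have h2 : expVal M (a₂ ⊗ₜ[ℂ] b₂) = 0 := by
    rw [hM, expVal_sepEffect, hex, hfx, hax, hbx, Complex.ofReal_re, Complex.ofReal_re,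
      Complex.ofReal_eq_zero]
    -- The aligned phases turn the expectation into the square of the left side of `hc0`.
    linear_combination (‖inner ℂ a₁ a₂‖ * ‖inner ℂ b₁ b₂‖ + c * (s * s')) * hc0
  have h3 : ∀ x y, expVal (LinearMap.id - M) (x ⊗ₜ[ℂ] y) =
      ((‖x‖ ^ 2 * ‖y‖ ^ 2 : ℝ) : ℂ) - expVal M (x ⊗ₜ[ℂ] y) := fun x y => by
    rw [expVal_sub, expVal_id_tmul]
  refine ⟨![M, LinearMap.id - M], ⟨?_, ?_⟩, ?_⟩
  · rw [Fin.forall_fin_two]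
    refine ⟨mem_SEPDual_iff.2 ⟨hsymm, re_expVal_sepEffect_nonneg a₁ e b₁ f c⟩,
      mem_SEPDual_iff.2 ⟨LinearMap.IsSymmetric.id.sub hsymm, fun x y => ?_⟩⟩
    change 0 ≤ (expVal (LinearMap.id - M) _).re
    rw [h3, Complex.sub_re, Complex.ofReal_re]
    exact sub_nonneg.2 (re_expVal_sepEffect_le ha₁ he hae hb₁ hf hbf hc x y)
  · simp [Fin.sum_univ_two]
  · simp only [Fin.forall_fin_two, Matrix.cons_val_zero, Matrix.cons_val_one, map_ketBra_ketBra,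
      trace_comp_ketBra_self, h3, h1, h2, ha₁, ha₂, hb₁, hb₂]
    simp

theorem PerfectlyDistinguishable.le_one {a₁ a₂ : HA} {b₁ b₂ : HB} (ha₁ : ‖a₁‖ = 1)
    (ha₂ : ‖a₂‖ = 1) (hb₁ : ‖b₁‖ = 1) (hb₂ : ‖b₂‖ = 1)
    (h : PerfectlyDistinguishable ![TensorProduct.map (ketBra a₁ a₁) (ketBra b₁ b₁),
      TensorProduct.map (ketBra a₂ a₂) (ketBra b₂ b₂)]) :
    ‖inner ℂ a₁ a₂‖ ^ 2 + ‖inner ℂ b₁ b₂‖ ^ 2 ≤ 1 := by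
  obtain ⟨M, ⟨hM, hsum⟩, htr⟩ := h
  have hpos := fun i => (mem_SEPDual_iff.1 (hM i)).2
  rw [Fin.sum_univ_two] at hsum
  have hadd : ∀ x y, (expVal (M 0) (x ⊗ₜ[ℂ] y)).re +
      (expVal (M 1) (x ⊗ₜ[ℂ] y)).re = ‖x‖ ^ 2 * ‖y‖ ^ 2 := fun x y => by
    rw [← Complex.add_re, ← expVal_add, hsum, expVal_id_tmul, Complex.ofReal_re]
  have h11 : (expVal (M 0) (a₁ ⊗ₜ[ℂ] b₁)).re = 1 := by
    have := htr 0 0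
    rw [Matrix.cons_val_zero, map_ketBra_ketBra, trace_comp_ketBra_self] at this
    simp [this]
  have h22 : (expVal (M 1) (a₂ ⊗ₜ[ℂ] b₂)).re = 1 := by
    have := htr 1 1
    rw [Matrix.cons_val_one, Matrix.cons_val_zero, map_ketBra_ketBra, trace_comp_ketBra_self] at this
    simp [this]
  -- Fixing one tensor factor compresses each effect to the other factor; both compressions are
  -- evaluated at the common vector `a₁ ⊗ b₂`.
  have hB : ‖inner ℂ b₁ b₂‖ ^ 2 ≤ (expVal (M 0) (a₁ ⊗ₜ[ℂ] b₂)).re :=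
    norm_inner_sq_le_of_compression (hM 0).1 (TensorProduct.mk ℂ HA HB a₁) (fun y => hpos 0 a₁ y)
      (fun y => by
        have := hadd a₁ y
        rw [ha₁, one_pow, one_mul] at this
        have h1 := hpos 1 a₁ y
        rw [TensorProduct.mk_apply]
        linarith) hb₁ h11 b₂
  have hA : ‖inner ℂ a₂ a₁‖ ^ 2 ≤ (expVal (M 1) (a₁ ⊗ₜ[ℂ] b₂)).re :=
    norm_inner_sq_le_of_compression (hM 1).1 ((TensorProduct.mk ℂ HA HB).flip b₂)
      (fun x => hpos 1 x b₂)
      (fun x => by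
        have := hadd x b₂
        rw [hb₂, one_pow, mul_one] at this
        have h1 := hpos 0 x b₂
        rw [LinearMap.flip_apply, TensorProduct.mk_apply]
        linarith) ha₂ h22 a₁
  have := hadd a₁ b₂
  rw [ha₁, hb₂] at this
  rw [norm_inner_symm] at hA
  linarith

theorem re_trace_ketBra_comp_ketBra {H : Type*} [NormedAddCommGroup H] [InnerProductSpace ℂ H]
    [FiniteDimensional ℂ H] (x y : H) :
    (LinearMap.trace ℂ H (ketBra x x ∘ₗ ketBra y y)).re = ‖inner ℂ x y‖ ^ 2 := by
  rw [trace_comp_ketBra_self, expVal, inner_ketBra_self, Complex.ofReal_re]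

end Discrimination

theorem theorem1 {HA HB : Type*}
    [NormedAddCommGroup HA] [InnerProductSpace ℂ HA] [FiniteDimensional ℂ HA]
    [NormedAddCommGroup HB] [InnerProductSpace ℂ HB] [FiniteDimensional ℂ HB]
    (ρ₁A ρ₂A : HA →ₗ[ℂ] HA) (ρ₁B ρ₂B : HB →ₗ[ℂ] HB)
    (h₁A : IsDensity ρ₁A) (h₂A : IsDensity ρ₂A) (h₁B : IsDensity ρ₁B) (h₂B : IsDensity ρ₂B)
    (h₁ : IsPureSEPState (TensorProduct.map ρ₁A ρ₁B))
    (h₂ : IsPureSEPState (TensorProduct.map ρ₂A ρ₂B)) :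
    PerfectlyDistinguishable ![TensorProduct.map ρ₁A ρ₁B, TensorProduct.map ρ₂A ρ₂B] ↔
      (LinearMap.trace ℂ HA (ρ₁A ∘ₗ ρ₂A)).re + (LinearMap.trace ℂ HB (ρ₁B ∘ₗ ρ₂B)).re ≤ 1 := by
  obtain ⟨a₁, ha₁, rfl⟩ := h₁.exists_left_eq_ketBra h₁A h₁B
  obtain ⟨b₁, hb₁, rfl⟩ := h₁.exists_right_eq_ketBra h₁A h₁B
  obtain ⟨a₂, ha₂, rfl⟩ := h₂.exists_left_eq_ketBra h₂A h₂B
  obtain ⟨b₂, hb₂, rfl⟩ := h₂.exists_right_eq_ketBra h₂A h₂B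
  rw [re_trace_ketBra_comp_ketBra, re_trace_ketBra_comp_ketBra]
  exact ⟨PerfectlyDistinguishable.le_one ha₁ ha₂ hb₁ hb₂,
    perfectlyDistinguishable_of_le ha₁ ha₂ hb₁ hb₂⟩
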